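/- Let $p$ be an odd prime and let $$F_p(x)=\sum_{a=1}^{p-1}\left(\frac{a}{p}\right)x^a\in\mathbb{Z}[x]$$ be the Fekete polynomial, where $\left(\frac{a}{p}\right)$ is the Legendre symbol. Then: (a) $x=1$ is a root of $F_p$ of multiplicity exactly $2$ if $p\equiv 1\pmod 4$, and of multiplicity exactly $1$ if $p\equiv 3\pmod 4$. (b) $x=-1$ is a root of $F_p$ of multiplicity exactly $1$ if $p\equiv 1\pmod 4$, and is not a root of $F_p$ if $p\equiv 3\pmod 4$. -/

import Mathlib

/-- The Fekete polynomial `F_p(x) = ∑_{a=1}^{p-1} (a/p) x^a`, where `(a/p)` is the Legendre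
symbol, as a polynomial with integer coefficients. -/
noncomputable def feketePolynomial (p : ℕ) [Fact p.Prime] : Polynomial ℤ :=
  ∑ a ∈ Finset.Icc 1 (p - 1), Polynomial.C (legendreSym p (a : ℤ)) * Polynomial.X ^ a

/-! Values and derivatives of `F_p` at `±1` are sums `∑ χ(x) g(x)` over residues, `χ` the Legendre
symbol. If `p ≡ 3 mod 4`, those needed are odd, or twice odd, hence nonzero. If `p ≡ 1 mod 4`, `χ`
is even and the reflection `x ↦ -x` kills `F_p'(1)` and `F_p(-1)`. It remains to show that `F_p''(1)
= S = ∑ χ(x) x²` and `F_p'(-1) = 2O`, with `O = ∑ χ(x) x (x mod 2)`, are nonzero. The substitution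
`x ↦ 2x` gives `(4χ(2) - 1) S = 2pO`, so `S ≠ 0` suffices; the Fourier series of the Bernoulli
polynomial `B₂` makes `S` a nonzero multiple of `L(2, χ)`, which is positive. -/

open Polynomial in
theorem feketePolynomial_eq_sum_zmod (p : ℕ) [Fact p.Prime] :
    feketePolynomial p = ∑ x : ZMod p, C (quadraticChar (ZMod p) x) * X ^ x.val := by
  have hp : 0 < p := (Fact.out : p.Prime).pos
  have h0 : ∑ x : ZMod p, C (quadraticChar (ZMod p) x) * X ^ x.val =
      ∑ x ∈ Finset.univ.erase (0 : ZMod p), C (quadraticChar (ZMod p) x) * X ^ x.val := by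
    rw [← Finset.add_sum_erase _ _ (Finset.mem_univ (0 : ZMod p))]
    simp
  rw [h0, feketePolynomial]
  refine Finset.sum_bij' (fun a _ => (a : ZMod p)) (fun x _ => x.val) ?_ ?_ ?_ ?_ ?_
  · intro a ha
    rw [Finset.mem_Icc] at ha
    simp only [Finset.mem_erase, Finset.mem_univ, and_true, ne_eq]
    rw [ZMod.natCast_eq_zero_iff]
    exact Nat.not_dvd_of_pos_of_lt (by omega) (by omega)
  · intro x hx
    have hx0 : x.val ≠ 0 := by
      simpa [ZMod.val_eq_zero] using hx
    have := ZMod.val_lt x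
    rw [Finset.mem_Icc]
    omega
  · intro a ha
    rw [Finset.mem_Icc] at ha
    exact ZMod.val_cast_of_lt (by omega)
  · intro x _
    exact ZMod.natCast_zmod_val x
  · intro a ha
    rw [Finset.mem_Icc] at ha
    rw [ZMod.val_cast_of_lt (show a < p by omega), legendreSym, Int.cast_natCast]

theorem neg_one_pow_eq_one_sub_mod_two (n : ℕ) : (-1 : ℤ) ^ n = 1 - 2 * ((n % 2 : ℕ) : ℤ) := by
  rcases Nat.mod_two_eq_zero_or_one n with h | h
  · rw [h, (Nat.even_iff.2 h).neg_one_pow]; norm_num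
  · rw [h, (Nat.odd_iff.2 h).neg_one_pow]; norm_num

theorem natCast_mul_neg_one_pow_pred (n : ℕ) :
    (n : ℤ) * (-1) ^ (n - 1) = 2 * (n * ((n % 2 : ℕ) : ℤ)) - n := by
  rcases n with _ | n
  · simp
  · have h := neg_one_pow_eq_one_sub_mod_two (n + 1)
    rw [pow_succ] at h
    rw [Nat.add_sub_cancel]
    linear_combination (-(n + 1 : ℕ) : ℤ) * h

/-! ### Values and derivatives at `±1` as character sums -/

section

variable (p : ℕ) [Fact p.Prime]

theorem quadraticChar_zmod_sum_eq_zero (hp : p ≠ 2) : ∑ x : ZMod p, quadraticChar (ZMod p) x = 0 :=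
  quadraticChar_sum_zero (by rwa [ZMod.ringChar_zmod_n])

theorem eval_one_feketePolynomial (hp : p ≠ 2) : (feketePolynomial p).eval 1 = 0 := by
  rw [feketePolynomial_eq_sum_zmod, Polynomial.eval_finsetSum]
  simpa using quadraticChar_zmod_sum_eq_zero p hp

theorem eval_one_derivative_feketePolynomial :
    (Polynomial.derivative (feketePolynomial p)).eval 1 =
      ∑ x : ZMod p, quadraticChar (ZMod p) x * (x.val : ℤ) := by
  rw [feketePolynomial_eq_sum_zmod, Polynomial.derivative_sum, Polynomial.eval_finsetSum]
  refine Finset.sum_congr rfl fun x _ => ?_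
  simp [Polynomial.derivative_X_pow, -ZMod.natCast_val]

theorem eval_one_derivative_derivative_feketePolynomial :
    (Polynomial.derivative (Polynomial.derivative (feketePolynomial p))).eval 1 =
      ∑ x : ZMod p, quadraticChar (ZMod p) x * (x.val : ℤ) ^ 2 -
        ∑ x : ZMod p, quadraticChar (ZMod p) x * (x.val : ℤ) := by
  rw [feketePolynomial_eq_sum_zmod, Polynomial.derivative_sum, Polynomial.derivative_sum,
    Polynomial.eval_finsetSum, ← Finset.sum_sub_distrib]
  refine Finset.sum_congr rfl fun x _ => ?_
  generalize x.val = n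
  rcases n with _ | n
  · simp
  · simp [Polynomial.derivative_X_pow]
    ring

theorem eval_neg_one_feketePolynomial (hp : p ≠ 2) :
    (feketePolynomial p).eval (-1) =
      -2 * ∑ x : ZMod p, quadraticChar (ZMod p) x * ((x.val % 2 : ℕ) : ℤ) := by
  rw [← add_zero (-2 * _), ← quadraticChar_zmod_sum_eq_zero p hp, Finset.mul_sum,
    ← Finset.sum_add_distrib, feketePolynomial_eq_sum_zmod, Polynomial.eval_finsetSum]
  refine Finset.sum_congr rfl fun x _ => ?_
  rw [Polynomial.eval_mul, Polynomial.eval_C, Polynomial.eval_pow, Polynomial.eval_X,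
    neg_one_pow_eq_one_sub_mod_two]
  ring

theorem eval_neg_one_derivative_feketePolynomial :
    (Polynomial.derivative (feketePolynomial p)).eval (-1) =
      2 * ∑ x : ZMod p, quadraticChar (ZMod p) x * (x.val * ((x.val % 2 : ℕ) : ℤ)) -
        ∑ x : ZMod p, quadraticChar (ZMod p) x * (x.val : ℤ) := by
  rw [feketePolynomial_eq_sum_zmod, Polynomial.derivative_sum, Polynomial.eval_finsetSum,
    Finset.mul_sum, ← Finset.sum_sub_distrib]
  refine Finset.sum_congr rfl fun x _ => ?_
  have h := natCast_mul_neg_one_pow_pred x.val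
  rw [Polynomial.derivative_C_mul, Polynomial.derivative_X_pow]
  simp only [Polynomial.eval_mul, Polynomial.eval_C, Polynomial.eval_pow, Polynomial.eval_X,
    map_natCast, Polynomial.eval_natCast]
  rw [h]
  ring

theorem ZMod.sum_comp_val {M : Type*} [AddCommMonoid M] (n : ℕ) [NeZero n] (f : ℕ → M) :
    ∑ x : ZMod n, f x.val = ∑ a ∈ Finset.range n, f a := by
  refine Finset.sum_bij' (fun x _ => x.val) (fun a _ => (a : ZMod n)) ?_ ?_ ?_ ?_ ?_
  · intro x _
    exact Finset.mem_range.2 (ZMod.val_lt x)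
  · simp
  · intro x _
    exact ZMod.natCast_zmod_val x
  · intro a ha
    exact ZMod.val_cast_of_lt (Finset.mem_range.1 ha)
  · simp

/-- Modulo 2 the signs `χ(x) = ±1` disappear, leaving `0 + 1 + ... + (p - 1) = p(p - 1)/2`. -/
theorem odd_sum_quadraticChar_mul (h3 : p % 4 = 3) (g : ℕ → ℤ)
    (hg : ∀ a : ℕ, (g a : ZMod 2) = a) :
    Odd (∑ x : ZMod p, quadraticChar (ZMod p) x * g x.val) := by
  rw [← ZMod.intCast_eq_one_iff_odd, Int.cast_sum]
  have h : ∀ x : ZMod p, ((quadraticChar (ZMod p) x * g x.val : ℤ) : ZMod 2) = (x.val : ZMod 2) := by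
    intro x
    by_cases hx : x = 0
    · simp [hx]
    · rw [Int.cast_mul, hg]
      rcases quadraticChar_dichotomy hx with h | h <;> rw [h]
      · simp
      · rw [Int.cast_neg, Int.cast_one, ZMod.neg_eq_self_mod_two, one_mul]
  simp_rw [h]
  rw [ZMod.sum_comp_val p (fun a => (a : ZMod 2)), ← Nat.cast_sum, ZMod.natCast_eq_one_iff_odd,
    Finset.sum_range_id]
  obtain ⟨k, hk⟩ : ∃ k, p = 4 * k + 3 := ⟨p / 4, by omega⟩
  have : p * (p - 1) / 2 = p * (2 * k + 1) := by
    rw [show p - 1 = (2 * k + 1) * 2 by omega, ← mul_assoc, Nat.mul_div_cancel _ (by norm_num)]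
  rw [this]
  exact Nat.odd_mul.2 ⟨⟨2 * k + 1, by omega⟩, ⟨k, rfl⟩⟩

/-! ### Reflection and doubling for `p ≡ 1 mod 4` -/

theorem quadraticChar_zmod_neg (h1 : p % 4 = 1) (x : ZMod p) :
    quadraticChar (ZMod p) (-x) = quadraticChar (ZMod p) x := by
  have h : quadraticChar (ZMod p) (-1) = 1 := by
    rw [quadraticChar_one_iff_isSquare (neg_ne_zero.2 one_ne_zero),
      ZMod.exists_sq_eq_neg_one_iff]
    omega
  rw [neg_eq_neg_one_mul, map_mul, h, one_mul]

theorem sum_quadraticChar_mul_eq_zero (h1 : p % 4 = 1) (c : ℤ) (g : ℕ → ℤ)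
    (hg : ∀ a ≤ p, g (p - a) = c - g a) :
    ∑ x : ZMod p, quadraticChar (ZMod p) x * g x.val = 0 := by
  have hp : p ≠ 2 := by rintro rfl; omega
  have hneg : ∑ x : ZMod p, quadraticChar (ZMod p) x * g x.val =
      ∑ x : ZMod p, (c * quadraticChar (ZMod p) x - quadraticChar (ZMod p) x * g x.val) := by
    rw [← Equiv.sum_comp (Equiv.neg (ZMod p))]
    refine Finset.sum_congr rfl fun x _ => ?_
    rw [Equiv.neg_apply, quadraticChar_zmod_neg p h1]
    -- The representative of `-x` is `p - x.val` except at `0`, where `χ` vanishes.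
    by_cases hx : x = 0
    · simp [hx]
    · rw [ZMod.neg_val, if_neg hx, hg _ (ZMod.val_lt x).le]
      ring
  rw [Finset.sum_sub_distrib, ← Finset.mul_sum, quadraticChar_zmod_sum_eq_zero p hp] at hneg
  linarith

theorem sum_quadraticChar_mul_val_eq_zero (h1 : p % 4 = 1) :
    ∑ x : ZMod p, quadraticChar (ZMod p) x * (x.val : ℤ) = 0 :=
  sum_quadraticChar_mul_eq_zero p h1 p (fun a => a) fun a ha => by push_cast [ha]; ring

theorem sum_quadraticChar_mul_val_mod_two_eq_zero (h1 : p % 4 = 1) :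
    ∑ x : ZMod p, quadraticChar (ZMod p) x * ((x.val % 2 : ℕ) : ℤ) = 0 :=
  sum_quadraticChar_mul_eq_zero p h1 1 (fun a => ((a % 2 : ℕ) : ℤ)) fun a ha => by omega

/-- Since `p` is odd, doubling wraps around exactly when the resulting residue is odd. -/
theorem two_mul_val_eq (hp : p ≠ 2) (x : ZMod p) :
    2 * (x.val : ℤ) = (2 * x).val + p * (((2 * x).val % 2 : ℕ) : ℤ) := by
  have hodd : p % 2 = 1 := (Fact.out : p.Prime).eq_two_or_odd.resolve_left hp
  rw [two_mul x]
  by_cases h : x.val + x.val < p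
  · rw [ZMod.val_add_of_lt h, show (x.val + x.val) % 2 = 0 by omega]
    push_cast
    ring
  · have h2 := ZMod.val_add_val_of_le (not_lt.1 h)
    rw [show (x + x).val % 2 = 1 by omega]
    push_cast
    omega

theorem four_mul_quadraticChar_two_mul_sum (h1 : p % 4 = 1) :
    4 * quadraticChar (ZMod p) 2 * ∑ x : ZMod p, quadraticChar (ZMod p) x * (x.val : ℤ) ^ 2 =
      ∑ x : ZMod p, quadraticChar (ZMod p) x * (x.val : ℤ) ^ 2 +
        2 * p * ∑ x : ZMod p, quadraticChar (ZMod p) x * (x.val * ((x.val % 2 : ℕ) : ℤ)) := by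
  have hp : p ≠ 2 := by rintro rfl; omega
  have h2 : (2 : ZMod p) ≠ 0 := by
    intro h
    have h' : ((2 : ℕ) : ZMod p) = 0 := by exact_mod_cast h
    rw [ZMod.natCast_eq_zero_iff] at h'
    exact hp ((Nat.prime_dvd_prime_iff_eq Fact.out Nat.prime_two).1 h')
  have hW := sum_quadraticChar_mul_val_mod_two_eq_zero p h1
  have key : 4 * quadraticChar (ZMod p) 2 *
      ∑ x : ZMod p, quadraticChar (ZMod p) x * (x.val : ℤ) ^ 2 =
      ∑ x : ZMod p, quadraticChar (ZMod p) x *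
        ((x.val : ℤ) + p * ((x.val % 2 : ℕ) : ℤ)) ^ 2 := by
    rw [← Equiv.sum_comp (Equiv.mulLeft₀ (2 : ZMod p) h2) (fun x : ZMod p =>
      quadraticChar (ZMod p) x * ((x.val : ℤ) + p * ((x.val % 2 : ℕ) : ℤ)) ^ 2), Finset.mul_sum]
    refine Finset.sum_congr rfl fun x _ => ?_
    rw [Equiv.mulLeft₀_apply, ← two_mul_val_eq p hp x, map_mul]
    ring
  -- With `w = x mod 2`, `w² = w` turns the last term of the expanded square into `p² ∑ χ(x) w`,
  -- which vanishes by reflection.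
  rw [key, ← add_zero (_ + _), ← mul_zero ((p : ℤ) ^ 2), ← hW, Finset.mul_sum, Finset.mul_sum,
    ← Finset.sum_add_distrib, ← Finset.sum_add_distrib]
  refine Finset.sum_congr rfl fun x _ => ?_
  have hw : ((x.val % 2 : ℕ) : ℤ) ^ 2 = ((x.val % 2 : ℕ) : ℤ) := by
    rcases Nat.mod_two_eq_zero_or_one x.val with h | h <;> rw [h] <;> norm_num
  linear_combination (quadraticChar (ZMod p) x * (p : ℤ) ^ 2) * hw

/-- For `p ≡ 1 mod 4` the Gauss sum of the Legendre symbol has nonzero real part, and the cosine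
sums twisted by the Legendre symbol are its multiples by Legendre symbols. -/
theorem exists_sum_quadraticChar_mul_cos (h1 : p % 4 = 1) :
    ∃ g : ℝ, g ≠ 0 ∧ ∀ n : ℕ, ∑ x : ZMod p, (quadraticChar (ZMod p) x : ℝ) *
      Real.cos (2 * Real.pi * n * (x.val / p)) = quadraticChar (ZMod p) n * g := by
  have hp : p ≠ 2 := by rintro rfl; omega
  set χ : MulChar (ZMod p) ℂ := (quadraticChar (ZMod p)).ringHomComp (Int.castRingHom ℂ) with hχ
  have hχa : ∀ x, χ x = ((quadraticChar (ZMod p) x : ℝ) : ℂ) := fun x => by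
    simp [hχ, MulChar.ringHomComp_apply]
  have hquad : χ.IsQuadratic := (quadraticChar_isQuadratic (ZMod p)).comp _
  have hne : χ ≠ 1 := by
    rw [hχ, MulChar.ringHomComp_ne_one_iff (RingHom.injective_int _)]
    exact quadraticChar_ne_one (by rwa [ZMod.ringChar_zmod_n])
  have hsq := gaussSum_sq hne hquad (ZMod.isPrimitive_stdAddChar p)
  set G := gaussSum χ (ZMod.stdAddChar (N := p)) with hG
  have hneg : χ (-1) = 1 := by
    rw [hχa, quadraticChar_zmod_neg p h1]
    simp
  rw [hneg, one_mul, ZMod.card] at hsq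
  refine ⟨G.re, ?_, fun n => ?_⟩
  -- A purely imaginary `G` would have `G²` with nonpositive real part, but `G² = p`.
  · intro h0
    have hre := congrArg Complex.re hsq
    rw [pow_two, Complex.mul_re, h0, Complex.natCast_re] at hre
    have : (0 : ℝ) < p := by exact_mod_cast (Fact.out : p.Prime).pos
    nlinarith [mul_self_nonneg G.im]
  · have hshift : ∑ x : ZMod p, χ x * ZMod.stdAddChar ((n : ZMod p) * x) = χ n * G := by
      by_cases hn : (n : ZMod p) = 0
      · rw [hn, MulChar.map_zero, zero_mul]
        simpa using MulChar.sum_eq_zero_of_ne_one hne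
      · have := gaussSum_mulShift_eq χ (ZMod.stdAddChar (N := p)) (Units.mk0 _ hn)
        rw [hquad.inv] at this
        simpa [hG, gaussSum, AddChar.mulShift_apply] using this
    have hre := congrArg Complex.re hshift
    rw [hχa, Complex.re_ofReal_mul, Complex.re_sum] at hre
    rw [← hre]
    refine Finset.sum_congr rfl fun x _ => ?_
    rw [hχa, Complex.re_ofReal_mul]
    have hx : (n : ZMod p) * x = ((n * x.val : ℤ) : ZMod p) := by
      push_cast
      rw [ZMod.natCast_zmod_val]
    have he : 2 * Real.pi * Complex.I * ((n * x.val : ℤ) : ℂ) / p =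
        ((2 * Real.pi * n * (x.val / p) : ℝ) : ℂ) * Complex.I := by
      push_cast
      ring
    rw [hx, ZMod.stdAddChar_coe, he, Complex.exp_ofReal_mul_I_re]

theorem hasSum_one_div_sq_mul_cos {x : ℝ} (hx : x ∈ Set.Icc (0 : ℝ) 1) :
    HasSum (fun n : ℕ => 1 / (n : ℝ) ^ 2 * Real.cos (2 * Real.pi * n * x))
      (Real.pi ^ 2 * (x ^ 2 - x + 1 / 6)) := by
  convert! hasSum_one_div_nat_pow_mul_cos (k := 1) one_ne_zero hx using 1
  have h : (Polynomial.map (algebraMap ℚ ℝ) (Polynomial.bernoulli (2 * 1))).eval x =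
      x ^ 2 - x + 1 / 6 := by
    simp [Polynomial.bernoulli_def, Finset.sum_range_succ, bernoulli_two]
    ring
  rw [h, mul_one, Nat.factorial_two]
  push_cast
  ring

/-- If the sum vanished, the `B₂` Fourier series twisted by `χ` would force `∑ χ(n)/n² = 0`. -/
theorem sum_quadraticChar_mul_val_sq_ne_zero (h1 : p % 4 = 1) :
    ∑ x : ZMod p, quadraticChar (ZMod p) x * (x.val : ℤ) ^ 2 ≠ 0 := by
  intro hS
  have hp : p ≠ 2 := by rintro rfl; omega
  have hp0 : (0 : ℝ) < p := by exact_mod_cast (Fact.out : p.Prime).pos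
  obtain ⟨g, hg, hcos⟩ := exists_sum_quadraticChar_mul_cos p h1
  have hsum : HasSum (fun n : ℕ => ∑ x : ZMod p, (quadraticChar (ZMod p) x : ℝ) *
      (1 / (n : ℝ) ^ 2 * Real.cos (2 * Real.pi * n * (x.val / p))))
      (∑ x : ZMod p, (quadraticChar (ZMod p) x : ℝ) *
        (Real.pi ^ 2 * ((x.val / p : ℝ) ^ 2 - x.val / p + 1 / 6))) := by
    refine hasSum_sum fun x _ => (hasSum_one_div_sq_mul_cos ⟨by positivity, ?_⟩).mul_left _
    rw [div_le_one hp0]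
    exact_mod_cast (ZMod.val_lt x).le
  have hval : ∑ x : ZMod p, (quadraticChar (ZMod p) x : ℝ) *
      (Real.pi ^ 2 * ((x.val / p : ℝ) ^ 2 - x.val / p + 1 / 6)) = 0 := by
    have e0 : ∑ x : ZMod p, (quadraticChar (ZMod p) x : ℝ) = 0 := by
      exact_mod_cast quadraticChar_zmod_sum_eq_zero p hp
    have e1 : ∑ x : ZMod p, (quadraticChar (ZMod p) x : ℝ) * (x.val : ℝ) = 0 := by
      exact_mod_cast sum_quadraticChar_mul_val_eq_zero p h1
    have e2 : ∑ x : ZMod p, (quadraticChar (ZMod p) x : ℝ) * (x.val : ℝ) ^ 2 = 0 := by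
      exact_mod_cast hS
    calc _ = Real.pi ^ 2 / p ^ 2 * ∑ x : ZMod p, (quadraticChar (ZMod p) x : ℝ) * (x.val : ℝ) ^ 2
          - Real.pi ^ 2 / p * ∑ x : ZMod p, (quadraticChar (ZMod p) x : ℝ) * (x.val : ℝ)
          + Real.pi ^ 2 / 6 * ∑ x : ZMod p, (quadraticChar (ZMod p) x : ℝ) := by
            rw [Finset.mul_sum, Finset.mul_sum, Finset.mul_sum, ← Finset.sum_sub_distrib,
              ← Finset.sum_add_distrib]
            refine Finset.sum_congr rfl fun x _ => ?_
            ring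
      _ = 0 := by rw [e0, e1, e2]; ring
  have hterm : ∀ n : ℕ, ∑ x : ZMod p, (quadraticChar (ZMod p) x : ℝ) *
      (1 / (n : ℝ) ^ 2 * Real.cos (2 * Real.pi * n * (x.val / p))) =
      g * (quadraticChar (ZMod p) n * (1 / (n : ℝ) ^ 2)) := by
    intro n
    rw [← mul_assoc, mul_comm g, ← hcos n, Finset.sum_mul]
    refine Finset.sum_congr rfl fun x _ => ?_
    ring
  simp_rw [hterm] at hsum
  rw [hval, ← mul_zero g, hasSum_mul_left_iff hg] at hsum
  -- Adding `ζ(2)` makes every term nonnegative; the term at `n = 1` is already `2 > π²/6`.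
  have htot := hsum.add hasSum_zeta_two
  have hle := le_hasSum htot 1 fun n _ => by
    have hn : (0 : ℝ) ≤ quadraticChar (ZMod p) n + 1 := by
      rcases quadraticChar_isQuadratic (ZMod p) n with h | h | h <;> rw [h] <;> norm_num
    have : (0 : ℝ) ≤ (quadraticChar (ZMod p) n + 1) * (1 / (n : ℝ) ^ 2) := by positivity
    linarith
  simp only [Nat.cast_one, MulChar.map_one, Int.cast_one] at hle
  nlinarith [Real.pi_lt_d2, Real.pi_pos]

theorem sum_quadraticChar_mul_val_mul_val_mod_two_ne_zero (h1 : p % 4 = 1) :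
    ∑ x : ZMod p, quadraticChar (ZMod p) x * (x.val * ((x.val % 2 : ℕ) : ℤ)) ≠ 0 := by
  intro hO
  have h := four_mul_quadraticChar_two_mul_sum p h1
  have hS := sum_quadraticChar_mul_val_sq_ne_zero p h1
  rw [hO, mul_zero, add_zero] at h
  -- `4χ(2) - 1` is never zero, so `h` would force the sum of squares to vanish.
  rcases quadraticChar_isQuadratic (ZMod p) 2 with h2 | h2 | h2 <;> rw [h2] at h <;> omega

end

theorem mainTheorem2 (p : ℕ) [Fact p.Prime] :
    ((p ≡ 1 [MOD 4] → (feketePolynomial p).rootMultiplicity 1 = 2) ∧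
      (p ≡ 3 [MOD 4] → (feketePolynomial p).rootMultiplicity 1 = 1)) ∧
    ((p ≡ 1 [MOD 4] → (feketePolynomial p).rootMultiplicity (-1) = 1) ∧
      (p ≡ 3 [MOD 4] → ¬ (feketePolynomial p).IsRoot (-1))) := by
  have hF1 := eval_one_derivative_feketePolynomial p
  have hF2 := eval_one_derivative_derivative_feketePolynomial p
  have hG1 := eval_neg_one_derivative_feketePolynomial p
  refine ⟨⟨fun h => ?_, fun h => ?_⟩, fun h => ?_, fun h => ?_⟩
  · have h1 : p % 4 = 1 := h
    have hp : p ≠ 2 := by rintro rfl; omega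
    have hF0 := eval_one_feketePolynomial p hp
    rw [sum_quadraticChar_mul_val_eq_zero p h1] at hF1 hF2
    rw [sub_zero] at hF2
    have hS := sum_quadraticChar_mul_val_sq_ne_zero p h1
    have hne : feketePolynomial p ≠ 0 := by
      intro h0
      rw [h0, Polynomial.derivative_zero, Polynomial.derivative_zero, Polynomial.eval_zero] at hF2
      exact hS hF2.symm
    have hlow := (Polynomial.one_lt_rootMultiplicity_iff_isRoot hne).2 ⟨hF0, hF1⟩
    have hhigh : ¬ 2 < (feketePolynomial p).rootMultiplicity 1 := by
      rw [Polynomial.lt_rootMultiplicity_iff_isRoot_iterate_derivative hne]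
      exact fun hr => hS (hF2.symm.trans (hr 2 le_rfl))
    omega
  · have h3 : p % 4 = 3 := h
    have hp : p ≠ 2 := by rintro rfl; omega
    have hF0 := eval_one_feketePolynomial p hp
    have hodd := odd_sum_quadraticChar_mul p h3 (fun a => a) (by simp)
    have hS : (Polynomial.derivative (feketePolynomial p)).eval 1 ≠ 0 := by
      rw [hF1]
      intro h0
      rw [h0] at hodd
      simp at hodd
    have hne : feketePolynomial p ≠ 0 := by
      intro h0
      simp [h0] at hS
    have hlow := (Polynomial.rootMultiplicity_pos hne).2 hF0
    have hhigh : ¬ 1 < (feketePolynomial p).rootMultiplicity 1 := by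
      rw [Polynomial.one_lt_rootMultiplicity_iff_isRoot hne]
      exact fun hr => hS hr.2
    omega
  · have h1 : p % 4 = 1 := h
    have hp : p ≠ 2 := by rintro rfl; omega
    have hG0 := eval_neg_one_feketePolynomial p hp
    rw [sum_quadraticChar_mul_val_mod_two_eq_zero p h1, mul_zero] at hG0
    rw [sum_quadraticChar_mul_val_eq_zero p h1, sub_zero] at hG1
    have hO := sum_quadraticChar_mul_val_mul_val_mod_two_ne_zero p h1
    have hS : (Polynomial.derivative (feketePolynomial p)).eval (-1) ≠ 0 := by
      rw [hG1]
      exact mul_ne_zero two_ne_zero hO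
    have hne : feketePolynomial p ≠ 0 := by
      intro h0
      simp [h0] at hS
    have hlow := (Polynomial.rootMultiplicity_pos hne).2 hG0
    have hhigh : ¬ 1 < (feketePolynomial p).rootMultiplicity (-1) := by
      rw [Polynomial.one_lt_rootMultiplicity_iff_isRoot hne]
      exact fun hr => hS hr.2
    omega
  · have h3 : p % 4 = 3 := h
    have hp : p ≠ 2 := by rintro rfl; omega
    have hodd := odd_sum_quadraticChar_mul p h3 (fun a => ((a % 2 : ℕ) : ℤ)) fun a => by
      rw [Int.cast_natCast, ZMod.natCast_mod]
    rw [Polynomial.IsRoot, eval_neg_one_feketePolynomial p hp]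
    intro h0
    rw [mul_eq_zero] at h0
    rw [h0.resolve_left (by norm_num)] at hodd
    simp at hodd
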